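/- Let $\pi:X\to B$ be a smooth (locally trivial) fibration with fiber $F$, where $X$ is a compact oriented smooth manifold (without boundary), $B$ is an oriented smooth manifold of dimension $2$, and $F$ is a smooth manifold of even dimension $2m$. Orient the fibers so that a positive basis of the tangent space to the fiber, followed by a lift of a positive basis of the tangent space of $B$, is a positive basis of the tangent space of $X$. A symplectic form $\omega$ on $X$ is called $\pi$-compatible if all fibers of $\pi$ are symplectic submanifolds of $(X,\omega)$ and the orientations that $\omega$ defines on $X$ and on the fibers (through the top powers of $\omega$) are the given ones. Two symplectic forms on $X$ are called isotopic if they can be joined by a smooth family of symplectic forms that all lie in the same cohomology class. Let $\omega_0,\omega_1$ be $\pi$-compatible forms on $X$. For $p\in X$ let $H_p\subset T_pX$ be the $\omega_0$-orthogonal complement of the tangent space at $p$ to the fiber through $p$, oriented through the isomorphism $d\pi_p:H_p\to T_{\pi(p)}B$. Assume that for every $p\in X$ the restriction of $\omega_1$ to $H_p$ is nondegenerate and positive. Suppose further that either $\dim F=2$, or $\omega_0$ and $\omega_1$ have equal restrictions to every fiber. Then the forms $$\omega_t=(1-t)\omega_0+t\omega_1,\qquad 0\le t\le 1,$$ are all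 nondegenerate. Hence, if in addition $\omega_0$ and $\omega_1$ are cohomologous, they are isotopic. -/

import Mathlib

open Set Filter Topology
open scoped Manifold ContDiff

noncomputable section

namespace SympFib

section Forms

variable {E : Type*} [NormedAddCommGroup E] [NormedSpace ℝ E]
  {M : Type*} [TopologicalSpace M] [ChartedSpace E M]

variable (E M) in
/-- Fields of alternating `k`-forms on the tangent spaces of `M` (no regularity yet). -/
abbrev FormField (k : ℕ) : Type _ :=
  ∀ x : M, (TangentSpace 𝓘(ℝ, E) x) [⋀^Fin k]→L[ℝ] ℝ

/-- The expression of a form in the preferred chart at `x₀`: its pullback under the inverse of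
that chart. It is meaningful on the target of the chart. -/
def localRep {k : ℕ} (α : FormField E M k) (x₀ : M) (y : E) : E [⋀^Fin k]→L[ℝ] ℝ :=
  (α ((chartAt E x₀).symm y)).compContinuousLinearMap
    (mfderiv 𝓘(ℝ, E) 𝓘(ℝ, E) (chartAt E x₀).symm y)

/-- Smooth differential forms. -/
def IsSmoothForm {k : ℕ} (α : FormField E M k) : Prop :=
  ∀ x₀ : M, ContDiffOn ℝ ∞ (localRep α x₀) (chartAt E x₀).target

/-- `dα = β`, where the exterior derivative is computed in charts. -/
def HasExtDeriv {k : ℕ} (α : FormField E M k) (β : FormField E M (k + 1)) : Prop :=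
  ∀ x₀ : M, ∀ y ∈ (chartAt E x₀).target, extDeriv (localRep α x₀) y = localRep β x₀ y

/-- Nondegeneracy of a `2`-form at every point. -/
def IsNondegenerate (ρ : FormField E M 2) : Prop :=
  ∀ (x : M) (v : TangentSpace 𝓘(ℝ, E) x),
    (∀ w : TangentSpace 𝓘(ℝ, E) x, ρ x ![v, w] = 0) → v = 0

/-- Symplectic forms: smooth, closed and nondegenerate `2`-forms. -/
structure IsSymplectic (ρ : FormField E M 2) : Prop where
  smooth : IsSmoothForm ρ
  closed : HasExtDeriv ρ 0
  nondegenerate : IsNondegenerate ρ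

/-- Two `2`-forms are cohomologous if they differ by the exterior derivative of a smooth
`1`-form. -/
def Cohomologous (ω₀ ω₁ : FormField E M 2) : Prop :=
  ∃ η : FormField E M 1, IsSmoothForm η ∧ HasExtDeriv η (ω₁ - ω₀)

/-- Smoothness of a family of forms `Ω t`, `0 ≤ t ≤ 1`, jointly in `t` and the point. -/
def IsSmoothFamily {k : ℕ} (Ω : ℝ → FormField E M k) : Prop :=
  ∀ x₀ : M, ContDiffOn ℝ ∞ (fun q : ℝ × E => localRep (Ω q.1) x₀ q.2)
    (Icc (0 : ℝ) 1 ×ˢ (chartAt E x₀).target)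

/-- Two symplectic forms are isotopic if they can be joined by a smooth family of symplectic forms
that all lie in the same cohomology class. -/
def Isotopic (ω₀ ω₁ : FormField E M 2) : Prop :=
  ∃ Ω : ℝ → FormField E M 2, IsSmoothFamily Ω ∧ Ω 0 = ω₀ ∧ Ω 1 = ω₁ ∧
    ∀ t ∈ Icc (0 : ℝ) 1, IsSymplectic (Ω t) ∧ Cohomologous ω₀ (Ω t)

end Forms

section Orientations

/-- The tuple `v` is a positively oriented basis of the oriented vector space `(V, o)`. -/
def IsPositive {V : Type*} [AddCommGroup V] [Module ℝ V] {k : ℕ}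
    (o : Orientation ℝ V (Fin k)) (v : Fin k → V) : Prop :=
  ∃ b : Module.Basis (Fin k) ℝ V, ⇑b = v ∧ b.orientation = o

/-- The value `ρ ^ m (v₀, …, v₂ₘ₋₁)` of the `m`-fold exterior power of a `2`-form `ρ`, up to a
positive factor that depends only on `m`:
`∑ σ, sign σ * ∏ i < m, ρ (v (σ (2 i)), v (σ (2 i + 1)))`. -/
def topPower {V : Type*} [AddCommGroup V] [Module ℝ V] [TopologicalSpace V] (m : ℕ)
    (ρ : V [⋀^Fin 2]→L[ℝ] ℝ) (v : Fin (2 * m) → V) : ℝ :=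
  ∑ σ : Equiv.Perm (Fin (2 * m)), ((Equiv.Perm.sign σ : ℤ) : ℝ) *
    ∏ i : Fin m, ρ ![v (σ ⟨2 * i, by omega⟩), v (σ ⟨2 * i + 1, by omega⟩)]

/-- An orientation of a manifold modelled on `E` (with `k = dim E`): an orientation of every
tangent space which is locally constant in charts. -/
structure ManifoldOrientation (k : ℕ) (E : Type*) [NormedAddCommGroup E] [NormedSpace ℝ E]
    (M : Type*) [TopologicalSpace M] [ChartedSpace E M] where
  /-- The orientation of each tangent space. -/
  orient : ∀ x : M, Orientation ℝ (TangentSpace 𝓘(ℝ, E) x) (Fin k)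
  locally_constant : ∀ x₀ : M, ∃ o : Orientation ℝ E (Fin k),
    ∀ᶠ y in 𝓝 (chartAt E x₀ x₀), ∀ b : Fin k → E,
      IsPositive o b ↔ IsPositive (orient ((chartAt E x₀).symm y))
        (fun i => mfderiv 𝓘(ℝ, E) 𝓘(ℝ, E) (chartAt E x₀).symm y (b i))

end Orientations

section Fibrations

variable {EX : Type*} [NormedAddCommGroup EX] [NormedSpace ℝ EX]
  {EB : Type*} [NormedAddCommGroup EB] [NormedSpace ℝ EB]
  {X : Type*} [TopologicalSpace X] [ChartedSpace EX X]
  {B : Type*} [TopologicalSpace B] [ChartedSpace EB B]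

/-- `π : X → B` is a smooth (locally trivial) fibration with fiber `F`. -/
def IsSmoothFibration (EF : Type*) [NormedAddCommGroup EF] [NormedSpace ℝ EF]
    (EX : Type*) [NormedAddCommGroup EX] [NormedSpace ℝ EX]
    (EB : Type*) [NormedAddCommGroup EB] [NormedSpace ℝ EB]
    {X : Type*} [TopologicalSpace X] [ChartedSpace EX X]
    {B : Type*} [TopologicalSpace B] [ChartedSpace EB B]
    (F : Type*) [TopologicalSpace F] [ChartedSpace EF F] (π : X → B) : Prop :=
  ∀ b : B, ∃ e : Bundle.Trivialization F π, b ∈ e.baseSet ∧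
    ContMDiffOn 𝓘(ℝ, EX) (𝓘(ℝ, EB).prod 𝓘(ℝ, EF)) ∞ e e.source ∧
    ContMDiffOn (𝓘(ℝ, EB).prod 𝓘(ℝ, EF)) 𝓘(ℝ, EX) ∞ e.toOpenPartialHomeomorph.symm e.target

variable (EX EB) in
/-- The derivative of `π` at `p`. -/
abbrev dproj (π : X → B) (p : X) :
    TangentSpace 𝓘(ℝ, EX) p →L[ℝ] TangentSpace 𝓘(ℝ, EB) (π p) :=
  mfderiv 𝓘(ℝ, EX) 𝓘(ℝ, EB) π p

variable (EX EB) in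
/-- The tangent space at `p` to the fiber of `π` through `p`. -/
def vertical (π : X → B) (p : X) : Submodule ℝ (TangentSpace 𝓘(ℝ, EX) p) :=
  LinearMap.ker (dproj EX EB π p).toLinearMap

variable (EB) in
/-- The `ρ`-horizontal space at `p`: the vectors that are `ρ`-orthogonal to the fiber. -/
def horizontal (π : X → B) (ρ : FormField EX X 2) (p : X) :
    Set (TangentSpace 𝓘(ℝ, EX) p) :=
  {u | ∀ v ∈ vertical EX EB π p, ρ p ![u, v] = 0}

/-- `ρ` is a `π`-compatible form, where `X` (of dimension `2 m + 2`) and `B` (of dimension `2`) are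
oriented: `ρ` is symplectic, the fibers are symplectic submanifolds, and the orientations that `ρ`
defines on `X` and on the fibers are the given ones. The fibers carry the orientation for which
a basis of the vertical space, followed by a lift of a positive basis of the tangent
space of `B`, is a positive basis of the tangent space of `X`. -/
structure IsCompatible (m : ℕ) (oX : ManifoldOrientation (2 * m + 2) EX X)
    (oB : ManifoldOrientation 2 EB B) (π : X → B) (ρ : FormField EX X 2) : Prop where
  symplectic : IsSymplectic ρ
  fiber_nondegenerate : ∀ (p : X), ∀ v ∈ vertical EX EB π p,
    (∀ w ∈ vertical EX EB π p, ρ p ![v, w] = 0) → v = 0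
  orients_total : ∀ (p : X) (v : Fin (2 * m + 2) → TangentSpace 𝓘(ℝ, EX) p),
    IsPositive (oX.orient p) v ↔ 0 < topPower (m + 1) (ρ p) v
  orients_fiber : ∀ (p : X) (v : Fin (2 * m) → TangentSpace 𝓘(ℝ, EX) p)
    (u w : TangentSpace 𝓘(ℝ, EX) p), (∀ i, v i ∈ vertical EX EB π p) →
    IsPositive (oB.orient (π p)) ![dproj EX EB π p u, dproj EX EB π p w] →
    (IsPositive (oX.orient p) (Fin.append v ![u, w]) ↔ 0 < topPower m (ρ p) v)

/-- The restriction of `ω₁` to each `ω₀`-horizontal space is nondegenerate, and positive for the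
orientation that this space inherits from `B` through the derivative of `π`. -/
def IsPositiveOnHorizontal (oB : ManifoldOrientation 2 EB B) (π : X → B)
    (ω₀ ω₁ : FormField EX X 2) : Prop :=
  ∀ p : X,
    (∀ u ∈ horizontal EB π ω₀ p, (∀ w ∈ horizontal EB π ω₀ p, ω₁ p ![u, w] = 0) → u = 0) ∧
    ∀ u ∈ horizontal EB π ω₀ p, ∀ w ∈ horizontal EB π ω₀ p,
      IsPositive (oB.orient (π p)) ![dproj EX EB π p u, dproj EX EB π p w] → 0 < ω₁ p ![u, w]

variable (EB) in
/-- `ω₀` and `ω₁` have the same restriction to every fiber of `π`. -/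
def EqualOnFibers (π : X → B) (ω₀ ω₁ : FormField EX X 2) : Prop :=
  ∀ (p : X), ∀ v ∈ vertical EX EB π p, ∀ w ∈ vertical EX EB π p,
    ω₀ p ![v, w] = ω₁ p ![v, w]

end Fibrations

end SympFib

end

/-!
Nondegeneracy of `ω_t` is a statement about each tangent space `V`. Let `W ⊆ V` be the vertical
space, which is the kernel of the surjection `L = dπ` (`dproj_surjective`).

On `W` the two forms satisfy `ω₀ = c ω₁` with a constant `c > 0`: if they agree on fibers then
`c = 1`, and if `W` is a plane then both are area forms of the same orientation
(`exists_pos_proportional`). Hence `ω_t = γ ω₁` on `W` with `γ = (1 - t) c + t > 0`. Take a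
positive basis of the tangent space of `B`, and let `u, u'` be its `ω₀`-horizontal and `k, k'` its
`ω₁`-horizontal lift. The `ω_t`-horizontal lift is `u - (t / γ) (u - k)`, `u' - (t / γ) (u' - k')`,
and the value of `ω_t` on it is
`(1 - t) ω₀(u, u') + t (ω₁(u, u') - (t / γ) q)`, where `q = ω₁(u - k, u' - k')`.
Here `ω₁(u, u') - q = ω₁(k, k')` and `0 ≤ t / γ ≤ 1`, so this value is positive once `ω₀(u, u')`,
`ω₁(u, u')` and `ω₁(k, k')` are. Then `ω_t` is nondegenerate both on `W` and on its orthogonal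
complement (`combination_nondegenerate`).

The number `ω₁(u, u')` is positive by hypothesis. The other two are positive because a compatible
form `ρ` induces the given orientations of total space and fiber, and the top power of `ρ` on a
vertical tuple `v` followed by a horizontal pair `u, w` is a positive multiple of the top power of
`ρ` on `v` times `ρ(u, w)` (`topPower_append`, `pos_on_orthogonal`).

If `ω₁ - ω₀ = dη`, then `ω_t - ω₀ = d(t η)`, so that the linear path is an isotopy
(`isotopic_of_linear`).
-/

namespace SympFib

/-! ### Top powers and orthogonal splittings -/

section TopPower

variable {V : Type*} [AddCommGroup V] [Module ℝ V] [TopologicalSpace V]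

theorem form_swap (ρ : V [⋀^Fin 2]→L[ℝ] ℝ) (x y : V) : ρ ![y, x] = -ρ ![x, y] := by
  have h := ρ.toAlternatingMap.map_swap ![x, y] (i := 0) (j := 1) (by decide)
  have e : (![x, y] : Fin 2 → V) ∘ Equiv.swap 0 1 = ![y, x] := by
    ext i; fin_cases i <;> simp
  rw [e] at h
  exact h

/-- The summand of `topPower` that belongs to the permutation `σ`. -/
def topPowerTerm (m : ℕ) (ρ : V [⋀^Fin 2]→L[ℝ] ℝ) (v : Fin (2 * m) → V)
    (σ : Equiv.Perm (Fin (2 * m))) : ℝ :=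
  ((Equiv.Perm.sign σ : ℤ) : ℝ) *
    ∏ i : Fin m, ρ ![v (σ ⟨2 * i, by omega⟩), v (σ ⟨2 * i + 1, by omega⟩)]

/-- Swapping the two arguments of a factor changes both the sign of the permutation and that of the
product. -/
theorem topPowerTerm_mul_swap_pair {m : ℕ} (ρ : V [⋀^Fin 2]→L[ℝ] ℝ) (v : Fin (2 * m) → V)
    (σ : Equiv.Perm (Fin (2 * m))) (i : Fin m) :
    topPowerTerm m ρ v (σ * Equiv.swap ⟨2 * i, by omega⟩ ⟨2 * i + 1, by omega⟩) =
      topPowerTerm m ρ v σ := by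
  unfold topPowerTerm
  set τ : Equiv.Perm (Fin (2 * m)) := Equiv.swap ⟨2 * i, by omega⟩ ⟨2 * i + 1, by omega⟩ with hτ
  have hf : ∀ j : Fin m,
      ρ ![v ((σ * τ) ⟨2 * j, by omega⟩), v ((σ * τ) ⟨2 * j + 1, by omega⟩)] =
      (if j = i then -1 else 1) *
        ρ ![v (σ ⟨2 * j, by omega⟩), v (σ ⟨2 * j + 1, by omega⟩)] := by
    intro j
    rw [Equiv.Perm.mul_apply, Equiv.Perm.mul_apply, hτ]
    by_cases h : j = i
    · subst h
      rw [Equiv.swap_apply_left, Equiv.swap_apply_right, form_swap]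
      simp
    · have h' : (j : ℕ) ≠ i := fun e => h (Fin.ext e)
      rw [Equiv.swap_apply_of_ne_of_ne (by simp; omega) (by simp; omega),
        Equiv.swap_apply_of_ne_of_ne (by simp; omega) (by simp; omega)]
      simp [h]
  rw [Finset.prod_congr rfl fun j _ => hf j, Finset.prod_mul_distrib, Equiv.Perm.sign_mul,
    Equiv.Perm.sign_swap (by simp)]
  simp

/-- Swapping two factors is an even permutation of the arguments. -/
theorem topPowerTerm_mul_swap_blocks {m : ℕ} (ρ : V [⋀^Fin 2]→L[ℝ] ℝ) (v : Fin (2 * m) → V)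
    (σ : Equiv.Perm (Fin (2 * m))) {i j : Fin m} (hij : i ≠ j) :
    topPowerTerm m ρ v (σ * (Equiv.swap ⟨2 * i, by omega⟩ ⟨2 * j, by omega⟩ *
      Equiv.swap ⟨2 * i + 1, by omega⟩ ⟨2 * j + 1, by omega⟩)) = topPowerTerm m ρ v σ := by
  have h' : (i : ℕ) ≠ j := fun e => hij (Fin.ext e)
  unfold topPowerTerm
  set τ₀ : Equiv.Perm (Fin (2 * m)) := Equiv.swap ⟨2 * i, by omega⟩ ⟨2 * j, by omega⟩ with hτ₀
  set τ₁ : Equiv.Perm (Fin (2 * m)) :=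
    Equiv.swap ⟨2 * i + 1, by omega⟩ ⟨2 * j + 1, by omega⟩ with hτ₁
  congr 1
  · rw [Equiv.Perm.sign_mul, Equiv.Perm.sign_mul, hτ₀, hτ₁, Equiv.Perm.sign_swap (by simpa),
      Equiv.Perm.sign_swap (by simpa)]
    simp
  · refine Fintype.prod_equiv (Equiv.swap i j) _ _ fun k => ?_
    have e0 : (τ₀ * τ₁) ⟨2 * k, by omega⟩ = ⟨2 * (Equiv.swap i j k : Fin m), by omega⟩ := by
      have : τ₁ ⟨2 * k, by omega⟩ = ⟨2 * k, by omega⟩ :=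
        Equiv.swap_apply_of_ne_of_ne (by simp; omega) (by simp; omega)
      rw [Equiv.Perm.mul_apply, this, hτ₀]
      simp only [Equiv.swap_apply_def, Fin.ext_iff]
      split_ifs <;> simp_all
    have e1 : (τ₀ * τ₁) ⟨2 * k + 1, by omega⟩ =
        ⟨2 * (Equiv.swap i j k : Fin m) + 1, by omega⟩ := by
      have : τ₁ ⟨2 * k + 1, by omega⟩ = ⟨2 * (Equiv.swap i j k : Fin m) + 1, by omega⟩ := by
        simp only [hτ₁, Equiv.swap_apply_def, Fin.ext_iff]
        split_ifs <;> simp_all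
      rw [Equiv.Perm.mul_apply, this, hτ₀,
        Equiv.swap_apply_of_ne_of_ne (by simp; omega) (by simp; omega)]
    rw [Equiv.Perm.mul_apply σ, Equiv.Perm.mul_apply σ, e0, e1]

/-- The preimage of the last index may be normalized to be the last index, since permutations that
preserve the blocks `{2 i, 2 i + 1}` do not change the summands of `topPower`. -/
theorem topPower_eq_sum_fix_last (m : ℕ) (ρ : V [⋀^Fin 2]→L[ℝ] ℝ) (v : Fin (2 * (m + 1)) → V) :
    topPower (m + 1) ρ v = (2 * (m + 1) : ℝ) *
      ∑ σ : Equiv.Perm (Fin (2 * (m + 1))),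
        if σ ⟨2 * m + 1, by omega⟩ = ⟨2 * m + 1, by omega⟩ then topPowerTerm (m + 1) ρ v σ
        else 0 := by
  set l : Fin (2 * (m + 1)) := ⟨2 * m + 1, by omega⟩ with hl
  -- Right multiplication by a symmetry `τ` of the summands moves the preimage of the last index.
  have translate : ∀ (k k' : Fin (2 * (m + 1))) (τ : Equiv.Perm (Fin (2 * (m + 1)))), τ k' = k →
      (∀ σ, topPowerTerm (m + 1) ρ v (σ * τ) = topPowerTerm (m + 1) ρ v σ) →
      (∑ σ : Equiv.Perm (Fin (2 * (m + 1))),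
        if σ k = l then topPowerTerm (m + 1) ρ v σ else 0) =
      ∑ σ : Equiv.Perm (Fin (2 * (m + 1))),
        if σ k' = l then topPowerTerm (m + 1) ρ v σ else 0 := by
    intro k k' τ hk hτ
    refine Fintype.sum_equiv (Equiv.mulRight τ) _ _ fun σ => ?_
    simp [hτ, hk]
  have odd : ∀ i : Fin (m + 1), (∑ σ : Equiv.Perm (Fin (2 * (m + 1))),
        if σ ⟨2 * i + 1, by omega⟩ = l then topPowerTerm (m + 1) ρ v σ else 0) =
      ∑ σ : Equiv.Perm (Fin (2 * (m + 1))),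
        if σ l = l then topPowerTerm (m + 1) ρ v σ else 0 := by
    intro i
    by_cases hi : i = Fin.last m
    · subst hi; rfl
    · refine translate _ _ _ ?_ fun σ => topPowerTerm_mul_swap_blocks ρ v σ hi
      have : (i : ℕ) ≠ m := fun e => hi (Fin.ext e)
      rw [Equiv.Perm.mul_apply]
      erw [Equiv.swap_apply_right]
      exact Equiv.swap_apply_of_ne_of_ne (by simp) (by simp; omega)
  have all : ∀ k : Fin (2 * (m + 1)), (∑ σ : Equiv.Perm (Fin (2 * (m + 1))),
        if σ k = l then topPowerTerm (m + 1) ρ v σ else 0) =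
      ∑ σ : Equiv.Perm (Fin (2 * (m + 1))),
        if σ l = l then topPowerTerm (m + 1) ρ v σ else 0 := by
    intro k
    obtain ⟨i, hi | hi⟩ : ∃ i : Fin (m + 1), (k : ℕ) = 2 * i ∨ (k : ℕ) = 2 * i + 1 :=
      ⟨⟨k / 2, by omega⟩, by simp only; omega⟩
    · have hk : k = ⟨2 * i, by omega⟩ := Fin.ext hi
      rw [← odd i, hk]
      exact translate _ _ _ (Equiv.swap_apply_right _ _)
        fun σ => topPowerTerm_mul_swap_pair ρ v σ i
    · have hk : k = ⟨2 * i + 1, by omega⟩ := Fin.ext hi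
      rw [hk, odd i]
  calc topPower (m + 1) ρ v = ∑ σ, topPowerTerm (m + 1) ρ v σ := rfl
    _ = ∑ σ : Equiv.Perm (Fin (2 * (m + 1))), ∑ k,
          if σ k = l then topPowerTerm (m + 1) ρ v σ else 0 := by
        refine Finset.sum_congr rfl fun σ _ => ?_
        rw [Finset.sum_eq_single (σ.symm l)]
        · simp
        · intro k _ hk
          rw [if_neg]
          rintro h
          exact hk (by rw [← h, Equiv.symm_apply_apply])
        · simp
    _ = _ := by
        rw [Finset.sum_comm, Finset.sum_congr rfl fun k _ => all k]
        simp

/-- The extension of a permutation of `Fin n` to `Fin (n + 2)` that fixes the last two indices. -/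
def extendPerm (n : ℕ) (τ : Equiv.Perm (Fin n)) : Equiv.Perm (Fin (n + 2)) :=
  finSumFinEquiv.permCongr (Equiv.Perm.sumCongr τ 1)

theorem extendPerm_castAdd {n : ℕ} (τ : Equiv.Perm (Fin n)) (i : Fin n) :
    extendPerm n τ (Fin.castAdd 2 i) = Fin.castAdd 2 (τ i) := by
  simp [extendPerm]

theorem extendPerm_natAdd {n : ℕ} (τ : Equiv.Perm (Fin n)) (i : Fin 2) :
    extendPerm n τ (Fin.natAdd n i) = Fin.natAdd n i := by
  simp [extendPerm]

theorem sign_extendPerm {n : ℕ} (τ : Equiv.Perm (Fin n)) :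
    Equiv.Perm.sign (extendPerm n τ) = Equiv.Perm.sign τ := by
  simp [extendPerm, Equiv.Perm.sign_sumCongr]

theorem extendPerm_injective (n : ℕ) : Function.Injective (extendPerm n) := by
  intro τ τ' h
  ext i
  have := congrArg (fun σ => σ (Fin.castAdd 2 i)) h
  simpa [extendPerm_castAdd] using congrArg Fin.val this

theorem exists_extendPerm_eq {n : ℕ} {σ : Equiv.Perm (Fin (n + 2))}
    (h : ∀ i : Fin 2, σ (Fin.natAdd n i) = Fin.natAdd n i) : ∃ τ, extendPerm n τ = σ := by
  have h1 : finSumFinEquiv.symm.permCongr σ ∈ (Equiv.Perm.sumCongrHom (Fin n) (Fin 2)).range := by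
    apply Equiv.Perm.mem_sumCongrHom_range_of_perm_mapsTo_inl
    rw [Equiv.Perm.perm_mapsTo_inl_iff_mapsTo_inr]
    rintro _ ⟨i, rfl⟩
    simp [h]
  obtain ⟨⟨τ, κ⟩, hτ⟩ := h1
  refine ⟨τ, ?_⟩
  ext1 x
  obtain ⟨y, rfl⟩ := finSumFinEquiv.surjective x
  rcases y with i | i
  · have := congrArg (fun f => finSumFinEquiv (f (Sum.inl i))) hτ
    simpa [extendPerm_castAdd] using this
  · simp [extendPerm_natAdd, h]

/-- If `w` is orthogonal to all `v i`, then only the permutations that pair `w` with `u` contribute,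
and the top power splits into the top power on `v` and the value on the pair `(u, w)`. -/
theorem topPower_append (m : ℕ) (ρ : V [⋀^Fin 2]→L[ℝ] ℝ) (v : Fin (2 * m) → V) (u w : V)
    (hw : ∀ i, ρ ![w, v i] = 0) :
    topPower (m + 1) ρ (Fin.append v ![u, w]) =
      (2 * (m + 1) : ℝ) * (topPower m ρ v * ρ ![u, w]) := by
  rw [topPower_eq_sum_fix_last]
  congr 1
  set V' : Fin (2 * m + 2) → V := Fin.append v ![u, w] with hV'
  have hVu : V' (Fin.natAdd (2 * m) 0) = u := by simp [hV']
  have hVw : V' (Fin.natAdd (2 * m) 1) = w := by simp [hV']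
  have hVv : ∀ i, V' (Fin.castAdd 2 i) = v i := by simp [hV']
  have term : ∀ τ : Equiv.Perm (Fin (2 * m)),
      topPowerTerm (m + 1) ρ V' (extendPerm (2 * m) τ) = topPowerTerm m ρ v τ * ρ ![u, w] := by
    intro τ
    unfold topPowerTerm
    rw [Fin.prod_univ_castSucc, ← mul_assoc]
    congr 1
    · congr 1
      · exact congrArg (fun s : ℤˣ => ((s : ℤ) : ℝ)) (sign_extendPerm τ)
      · refine Finset.prod_congr rfl fun i _ => ?_
        rw [← hVv, ← hVv, ← extendPerm_castAdd, ← extendPerm_castAdd]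
        rfl
    · rw [← hVu, ← hVw]
      conv_rhs => rw [← extendPerm_natAdd τ 0, ← extendPerm_natAdd τ 1]
      rfl
  rw [topPower, Finset.sum_mul]
  symm
  refine Finset.sum_of_injOn (extendPerm (2 * m)) (extendPerm_injective _).injOn
    (fun _ _ => Finset.mem_coe.2 (Finset.mem_univ _)) ?_ ?_
  · intro σ _ hσ
    split_ifs with hl
    · -- If `σ` fixes only the last index, `w` is paired with some `v i`, and the product vanishes.
      change Equiv.Perm (Fin (2 * m + 2)) at σ
      have hl' : σ (Fin.natAdd (2 * m) 1) = Fin.natAdd (2 * m) 1 := hl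
      have hu : σ (Fin.natAdd (2 * m) 0) ≠ Fin.natAdd (2 * m) 0 := by
        intro h0
        obtain ⟨τ, rfl⟩ := exists_extendPerm_eq (σ := σ)
          (fun i => by fin_cases i <;> assumption)
        exact hσ ⟨τ, by simp, rfl⟩
      have hne : σ (Fin.natAdd (2 * m) 0) ≠ Fin.natAdd (2 * m) 1 := by
        rw [← hl']
        intro h
        have := congrArg Fin.val (σ.injective h)
        simp at this
      obtain ⟨i, hi⟩ : ∃ i : Fin (2 * m), σ (Fin.natAdd (2 * m) 0) = Fin.castAdd 2 i := by
        generalize σ (Fin.natAdd (2 * m) 0) = x at hu hne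
        have h0 : (x : ℕ) ≠ 2 * m := fun e => hu (Fin.ext (by simpa using e))
        have h1 : (x : ℕ) ≠ 2 * m + 1 := fun e => hne (Fin.ext (by simpa using e))
        exact ⟨⟨x, by omega⟩, rfl⟩
      unfold topPowerTerm
      rw [Finset.prod_eq_zero (Finset.mem_univ (Fin.last m)), mul_zero]
      change ρ ![V' (σ (Fin.natAdd (2 * m) 0)), V' (σ (Fin.natAdd (2 * m) 1))] = 0
      rw [hi, hl', hVv, hVw, form_swap, hw, neg_zero]
    · rfl
  · intro τ _
    rw [← topPowerTerm, ← term τ]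
    exact (if_pos (extendPerm_natAdd τ 1)).symm

end TopPower

/-! ### Linear algebra of a segment of alternating forms -/

section LinearAlgebra

variable {V V' : Type*} [AddCommGroup V] [Module ℝ V] [AddCommGroup V'] [Module ℝ V']

/-- A `2`-form as a bilinear form. -/
noncomputable def toBilinForm [TopologicalSpace V] (ρ : V [⋀^Fin 2]→L[ℝ] ℝ) :
    LinearMap.BilinForm ℝ V :=
  LinearMap.mk₂ ℝ (fun x y => ρ ![x, y])
    (fun x x' y => by
      exact ρ.toAlternatingMap.map_vecCons_add ![y] x x')
    (fun c x y => ρ.toAlternatingMap.map_vecCons_smul ![y] c x)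
    (fun x y y' => by
      rw [form_swap ρ (y + y'), form_swap ρ y, form_swap ρ y', ← neg_add]
      exact congrArg Neg.neg (ρ.toAlternatingMap.map_vecCons_add ![x] y y'))
    (fun c x y => by
      rw [form_swap ρ (c • y), form_swap ρ y, smul_neg]
      exact congrArg Neg.neg (ρ.toAlternatingMap.map_vecCons_smul ![x] c y))

@[simp]
theorem toBilinForm_apply [TopologicalSpace V] (ρ : V [⋀^Fin 2]→L[ℝ] ℝ) (x y : V) :
    toBilinForm ρ x y = ρ ![x, y] := rfl

theorem toBilinForm_isAlt [TopologicalSpace V] (ρ : V [⋀^Fin 2]→L[ℝ] ℝ) :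
    (toBilinForm ρ).IsAlt := by
  intro x
  have := form_swap ρ x x
  rw [toBilinForm_apply]
  linarith

/-- The orthogonal complement of a subspace on which an alternating form is nondegenerate maps
onto the target of `L`. -/
theorem exists_orthogonal_lift [FiniteDimensional ℝ V] {B : LinearMap.BilinForm ℝ V}
    (hB : B.IsAlt) {L : V →ₗ[ℝ] V'} (hL : Function.Surjective L)
    (hnd : ∀ v ∈ LinearMap.ker L, (∀ w ∈ LinearMap.ker L, B v w = 0) → v = 0) (y : V') :
    ∃ u, L u = y ∧ ∀ w ∈ LinearMap.ker L, B u w = 0 := by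
  have hres : (B.restrict (LinearMap.ker L)).Nondegenerate := by
    refine ⟨fun v hv => ?_, fun v hv => ?_⟩
    · exact Subtype.ext (hnd v v.2 fun w hw => hv ⟨w, hw⟩)
    · refine Subtype.ext (hnd v v.2 fun w hw => ?_)
      rw [← hB.neg_eq, neg_eq_zero]
      exact hv ⟨w, hw⟩
  have hc := B.isCompl_orthogonal_of_restrict_nondegenerate hB.isRefl hres
  obtain ⟨x, rfl⟩ := hL y
  obtain ⟨w, hw, u, hu, rfl⟩ :=
    Submodule.mem_sup.1 (hc.sup_eq_top ▸ Submodule.mem_top : x ∈ LinearMap.ker L ⊔ _)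
  refine ⟨u, by rw [map_add, LinearMap.mem_ker.1 hw, zero_add], fun z hz => ?_⟩
  exact hB.isRefl _ _ (hu z hz)

/-- A form that is nondegenerate on the kernel of `L` and nonzero on a pair of orthogonal lifts of
spanning vectors is nondegenerate. -/
theorem eq_zero_of_forall_eq_zero {B : LinearMap.BilinForm ℝ V} (hB : B.IsAlt) {L : V →ₗ[ℝ] V'}
    (hnd : ∀ v ∈ LinearMap.ker L, (∀ w ∈ LinearMap.ker L, B v w = 0) → v = 0) {h h' : V}
    (hspan : ∀ y, ∃ a b : ℝ, L y = a • L h + b • L h')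
    (hh : ∀ w ∈ LinearMap.ker L, B h w = 0) (hh' : ∀ w ∈ LinearMap.ker L, B h' w = 0)
    (hne : B h h' ≠ 0) {x : V} (hx : ∀ y, B x y = 0) : x = 0 := by
  obtain ⟨a, b, hab⟩ := hspan x
  have hxe : x - (a • h + b • h') = 0 := by
    refine hnd _ (by simp [hab]) fun w hw => ?_
    simp [hx, hh w hw, hh' w hw]
  have hx' : x = a • h + b • h' := sub_eq_zero.1 hxe
  have ha : a = 0 := by
    have := hx h'
    rw [hx'] at this
    simpa [hB.self_eq_zero, hne] using this
  have hb : b = 0 := by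
    have := hx h
    rw [hx'] at this
    have hne' : B h' h ≠ 0 := by rw [← hB.neg_eq]; simpa using hne
    simpa [hB.self_eq_zero, hne'] using this
  rw [hx', ha, hb]; simp

/-- The pointwise statement behind nondegeneracy of the linear path. The forms are
positively proportional on `ker L`; the vectors `u`, `u'` and `k`, `k'` are orthogonal lifts of
the same two vectors with respect to `B₀` and `B₁`. -/
theorem combination_nondegenerate {B₀ B₁ : LinearMap.BilinForm ℝ V} (hB₀ : B₀.IsAlt)
    (hB₁ : B₁.IsAlt) {L : V →ₗ[ℝ] V'}
    (hnd : ∀ v ∈ LinearMap.ker L, (∀ w ∈ LinearMap.ker L, B₁ v w = 0) → v = 0)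
    {c : ℝ} (hc : 0 < c)
    (hprop : ∀ v ∈ LinearMap.ker L, ∀ w ∈ LinearMap.ker L, B₀ v w = c * B₁ v w)
    {u u' k k' : V} (huk : L u = L k) (huk' : L u' = L k')
    (hspan : ∀ y, ∃ a b : ℝ, L y = a • L u + b • L u')
    (hu : ∀ w ∈ LinearMap.ker L, B₀ u w = 0) (hu' : ∀ w ∈ LinearMap.ker L, B₀ u' w = 0)
    (hk : ∀ w ∈ LinearMap.ker L, B₁ k w = 0) (hk' : ∀ w ∈ LinearMap.ker L, B₁ k' w = 0)
    (h₀ : 0 < B₀ u u') (h₁ : 0 < B₁ u u') (h₂ : 0 < B₁ k k')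
    {t : ℝ} (ht : t ∈ Icc (0 : ℝ) 1) {x : V}
    (hx : ∀ y, (1 - t) * B₀ x y + t * B₁ x y = 0) : x = 0 := by
  obtain ⟨ht0, ht1⟩ := ht
  -- On `ker L` the form `(1 - t) B₀ + t B₁` is `γ B₁`.
  set γ : ℝ := (1 - t) * c + t with hγ
  have hγt : t ≤ γ := by nlinarith [mul_nonneg (sub_nonneg.2 ht1) hc.le]
  have hγ0 : 0 < γ := by
    rcases ht0.eq_or_lt with h | h
    · rw [hγ, ← h]; simpa
    · exact h.trans_le hγt
  have hd : u - k ∈ LinearMap.ker L := by simp [huk]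
  have hd' : u' - k' ∈ LinearMap.ker L := by simp [huk']
  set s : ℝ := t / γ with hs
  have hsγ : s * γ = t := div_mul_cancel₀ _ hγ0.ne'
  have hs0 : 0 ≤ s := div_nonneg ht0 hγ0.le
  have hs1 : s ≤ 1 := (div_le_one hγ0).2 hγt
  clear_value s γ
  have hBk : ∀ w ∈ LinearMap.ker L, B₁ (u - k) w = B₁ u w := fun w hw => by simp [hk w hw]
  have hBk' : ∀ w ∈ LinearMap.ker L, B₁ (u' - k') w = B₁ u' w := fun w hw => by simp [hk' w hw]
  have h₃ : B₁ k k' = B₁ u u' - B₁ (u - k) (u' - k') := by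
    have e1 := hk _ hd'
    have e2 := hk' _ hd
    rw [← hB₁.neg_eq, neg_eq_zero] at e2
    simp only [map_sub, LinearMap.sub_apply] at e1 e2 ⊢
    linarith
  refine eq_zero_of_forall_eq_zero (B := (1 - t) • B₀ + t • B₁) (L := L)
    (h := u - s • (u - k)) (h' := u' - s • (u' - k')) ?_ ?_ ?_ ?_ ?_ ?_ ?_
  · intro y; simp [hB₀.self_eq_zero, hB₁.self_eq_zero]
  · intro v hv hvw
    refine hnd v hv fun w hw => ?_
    have := hvw w hw
    simp only [LinearMap.add_apply, LinearMap.smul_apply, smul_eq_mul, hprop v hv w hw] at this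
    have h' : γ * B₁ v w = 0 := by rw [hγ]; linarith
    exact (mul_eq_zero.1 h').resolve_left hγ0.ne'
  · intro y
    obtain ⟨a, b, h⟩ := hspan y
    exact ⟨a, b, by simp [h, huk, huk']⟩
  · intro w hw
    have e := hprop _ hd w hw
    have e' := hBk w hw
    have e0 := hu w hw
    rw [e'] at e
    generalize u - k = d at *
    simp only [LinearMap.add_apply, LinearMap.smul_apply, smul_eq_mul, map_sub,
      LinearMap.sub_apply, map_smul, e, e', e0]
    rw [hγ] at hsγ
    linear_combination (-B₁ u w) * hsγ
  · intro w hw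
    have e := hprop _ hd' w hw
    have e' := hBk' w hw
    have e0 := hu' w hw
    rw [e'] at e
    generalize u' - k' = d at *
    simp only [LinearMap.add_apply, LinearMap.smul_apply, smul_eq_mul, map_sub,
      LinearMap.sub_apply, map_smul, e, e', e0]
    rw [hγ] at hsγ
    linear_combination (-B₁ u' w) * hsγ
  · -- The value on the two lifts is `(1 - t) B₀ u u' + t B₁ u u' - t s q`.
    set q := B₁ (u - k) (u' - k') with hq
    have e0 : B₀ (u - k) u' = 0 := by rw [← hB₀.neg_eq, hu' _ hd, neg_zero]
    have e1 : B₀ u (u' - k') = 0 := hu _ hd'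
    have e2 : B₀ (u - k) (u' - k') = c * q := hprop _ hd _ hd'
    have e3 : B₁ u (u' - k') = q := (hBk _ hd').symm
    have e4 : B₁ (u - k) u' = q := by
      rw [← hB₁.neg_eq, ← hBk' _ hd, hB₁.neg_eq]
    have key : ((1 - t) • B₀ + t • B₁) (u - s • (u - k)) (u' - s • (u' - k')) =
        (1 - t) * B₀ u u' + t * B₁ u u' - t * s * q := by
      generalize u - k = d at *
      generalize u' - k' = d' at *
      simp only [LinearMap.add_apply, LinearMap.smul_apply, smul_eq_mul, map_sub,
        LinearMap.sub_apply, map_smul, e0, e1, e2, e3, e4, ← hq]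
      rw [hγ] at hsγ
      linear_combination (s * q) * hsγ
    rw [key]
    apply ne_of_gt
    have hqb : q < B₁ u u' := by linarith
    have hsq : s * q < B₁ u u' := by
      rcases le_or_gt q 0 with h | h
      · exact (mul_nonpos_of_nonneg_of_nonpos hs0 h).trans_lt h₁
      · nlinarith
    rcases ht0.eq_or_lt with h | h
    · rw [← h]; simpa
    · have := mul_nonneg (sub_nonneg.2 ht1) h₀.le
      nlinarith [mul_pos h (sub_pos.2 hsq)]
  · intro y
    simpa using hx y

end LinearAlgebra

/-! ### Orientations and signs on the kernel and its orthogonal complement -/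

section Positivity

variable {V V' : Type*} [AddCommGroup V] [Module ℝ V] [AddCommGroup V'] [Module ℝ V']

theorem finrank_ker_of_surjective [FiniteDimensional ℝ V] [FiniteDimensional ℝ V'] {m : ℕ}
    (hV : Module.finrank ℝ V = 2 * m + 2) (hV' : Module.finrank ℝ V' = 2)
    {L : V →ₗ[ℝ] V'} (hL : Function.Surjective L) :
    Module.finrank ℝ (LinearMap.ker L) = 2 * m := by
  have h := L.finrank_range_add_finrank_ker
  rw [LinearMap.range_eq_top.2 hL, finrank_top] at h
  omega

/-- A basis of the kernel of `L`, followed by lifts of linearly independent vectors, is linearly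
independent. -/
theorem linearIndependent_append_lift {n : ℕ} {L : V →ₗ[ℝ] V'}
    {b : Fin n → LinearMap.ker L} (hb : LinearIndependent ℝ b) {u w : V}
    (h : LinearIndependent ℝ ![L u, L w]) :
    LinearIndependent ℝ (Fin.append (fun i => (b i : V)) ![u, w]) := by
  have hq : LinearIndependent ℝ (Submodule.Quotient.mk (p := LinearMap.ker L) ∘ ![u, w]) := by
    refine LinearIndependent.of_comp ((LinearMap.ker L).liftQ L le_rfl) ?_
    convert h using 1
    ext i; fin_cases i <;> simp
  have := LinearIndependent.sumElim_of_quotient hb _ hq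
  rw [← linearIndependent_equiv finSumFinEquiv]
  have e : Fin.append (fun i => (b i : V)) ![u, w] ∘ finSumFinEquiv =
      Sum.elim (fun i => (b i : V)) ![u, w] := by
    ext i; rcases i with i | i <;> simp
  rwa [e]

theorem topPower_zero [TopologicalSpace V] (ρ : V [⋀^Fin 2]→L[ℝ] ℝ) (v : Fin (2 * 0) → V) :
    topPower 0 ρ v = 1 := by
  have : Subsingleton (Fin (2 * 0)) := inferInstanceAs (Subsingleton (Fin 0))
  rw [topPower, Fintype.sum_subsingleton _ 1]
  simp

theorem topPower_one [TopologicalSpace V] (ρ : V [⋀^Fin 2]→L[ℝ] ℝ) (x y : V) :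
    topPower 1 ρ ![x, y] = 2 * ρ ![x, y] := by
  have h := topPower_append 0 ρ Fin.elim0 x y fun i => i.elim0
  rw [topPower_zero] at h
  have e : (Fin.append Fin.elim0 ![x, y] : Fin (2 * 0 + 2) → V) = ![x, y] := by
    ext i; fin_cases i <;> rfl
  rw [e] at h
  simpa using h

/-- A form that induces the given orientations on the total space and on the kernel of `L` is
positive on the orthogonal complement of the kernel. -/
theorem pos_on_orthogonal [TopologicalSpace V] [FiniteDimensional ℝ V] [FiniteDimensional ℝ V']
    {m : ℕ} (hV : Module.finrank ℝ V = 2 * m + 2) (hV' : Module.finrank ℝ V' = 2)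
    {L : V →ₗ[ℝ] V'} (hL : Function.Surjective L) {o : Orientation ℝ V (Fin (2 * m + 2))}
    {o' : Orientation ℝ V' (Fin 2)} {ρ : V [⋀^Fin 2]→L[ℝ] ℝ}
    (htot : ∀ v : Fin (2 * m + 2) → V, IsPositive o v ↔ 0 < topPower (m + 1) ρ v)
    (hfib : ∀ (v : Fin (2 * m) → V) (u w : V), (∀ i, v i ∈ LinearMap.ker L) →
      IsPositive o' ![L u, L w] → (IsPositive o (Fin.append v ![u, w]) ↔ 0 < topPower m ρ v))
    {u w : V} (hw : ∀ v ∈ LinearMap.ker L, ρ ![w, v] = 0) (huw : IsPositive o' ![L u, L w]) :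
    0 < ρ ![u, w] := by
  -- It suffices to find a basis of the kernel for which the whole tuple is positive.
  suffices h : ∃ v : Fin (2 * m) → V, (∀ i, v i ∈ LinearMap.ker L) ∧
      IsPositive o (Fin.append v ![u, w]) by
    obtain ⟨v, hv, hpos⟩ := h
    have h1 := (hfib v u w hv huw).1 hpos
    have h2 := (htot _).1 hpos
    rw [topPower_append m ρ v u w fun i => hw _ (hv i)] at h2
    exact (mul_pos_iff_of_pos_left h1).1 ((mul_pos_iff_of_pos_left (by positivity)).1 h2)
  let b := Module.finBasisOfFinrankEq ℝ (LinearMap.ker L) (finrank_ker_of_surjective hV hV' hL)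
  have hli : LinearIndependent ℝ ![L u, L w] := by
    obtain ⟨e, he, -⟩ := huw
    exact he ▸ e.linearIndependent
  have hli' := linearIndependent_append_lift b.linearIndependent hli
  let B := basisOfLinearIndependentOfCardEqFinrank hli' (by simp [hV])
  have hB : ⇑B = Fin.append (fun i => (b i : V)) ![u, w] :=
    coe_basisOfLinearIndependentOfCardEqFinrank _ _
  rcases B.orientation_eq_or_eq_neg o with ho | ho
  · exact ⟨_, fun i => (b i).2, B, hB, ho.symm⟩
  · rcases m.eq_zero_or_pos with rfl | hm
    · -- Without fiber directions, positivity is the fiber condition for the empty tuple.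
      refine ⟨fun i => b i, fun i => (b i).2, ?_⟩
      rw [hfib _ _ _ (fun i => (b i).2) huw, topPower_zero]
      exact one_pos
    · let i₀ : Fin (2 * m) := ⟨0, by omega⟩
      refine ⟨Function.update (fun i => (b i : V)) i₀ (-(b i₀ : V)), fun i => ?_,
        B.unitsSMul (Function.update 1 (Fin.castAdd 2 i₀) (-1)), ?_, ?_⟩
      · rcases eq_or_ne i i₀ with rfl | h
        · simp
        · simp [Function.update_of_ne h]
      · ext j
        rw [Module.Basis.unitsSMul_apply, hB]
        refine Fin.addCases (fun j => ?_) (fun j => ?_) j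
        · rcases eq_or_ne j i₀ with rfl | h
          · simp
          · have : Fin.castAdd 2 j ≠ Fin.castAdd 2 i₀ := by simpa using h
            simp [Function.update_of_ne h, Function.update_of_ne this]
        · have : Fin.natAdd (2 * m) j ≠ Fin.castAdd 2 i₀ := by
            intro h
            have := congrArg Fin.val h
            simp at this
            omega
          simp [Function.update_of_ne this]
      · rw [Module.Basis.orientation_neg_single, ho]

/-- On a plane, two alternating forms that have the same sign are positively proportional. -/
theorem exists_pos_proportional [TopologicalSpace V] {W : Submodule ℝ V}
    (hW : Module.finrank ℝ W = 2) {ρ₀ ρ₁ : V [⋀^Fin 2]→L[ℝ] ℝ}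
    (hnd : ∀ v ∈ W, (∀ w ∈ W, ρ₀ ![v, w] = 0) → v = 0)
    (hsign : ∀ x ∈ W, ∀ y ∈ W, LinearIndependent ℝ ![x, y] → (0 < ρ₀ ![x, y] ↔ 0 < ρ₁ ![x, y])) :
    ∃ c : ℝ, 0 < c ∧ ∀ v ∈ W, ∀ w ∈ W, ρ₀ ![v, w] = c * ρ₁ ![v, w] := by
  have : FiniteDimensional ℝ W := Module.finite_of_finrank_pos (by omega)
  let b := Module.finBasisOfFinrankEq ℝ W hW
  have hli : LinearIndependent ℝ ![(b 0 : V), b 1] := by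
    have h := b.linearIndependent.map' W.subtype W.ker_subtype
    have e : ![(b 0 : V), b 1] = W.subtype ∘ b := by ext i; fin_cases i <;> rfl
    rwa [e]
  have hexp : ∀ v ∈ W, ∃ α β : ℝ, v = α • (b 0 : V) + β • (b 1 : V) := by
    intro v hv
    have h := congrArg (Subtype.val) (b.sum_repr ⟨v, hv⟩)
    rw [Fin.sum_univ_two] at h
    exact ⟨_, _, h.symm⟩
  have hval : ∀ (ρ : V [⋀^Fin 2]→L[ℝ] ℝ) (α β γ δ : ℝ),
      ρ ![α • (b 0 : V) + β • (b 1 : V), γ • (b 0 : V) + δ • (b 1 : V)] =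
        (α * δ - β * γ) * ρ ![(b 0 : V), b 1] := by
    intro ρ α β γ δ
    have h0 := (toBilinForm_isAlt ρ).self_eq_zero (b 0 : V)
    have h1 := (toBilinForm_isAlt ρ).self_eq_zero (b 1 : V)
    have h2 := (toBilinForm_isAlt ρ).neg_eq (b 0 : V) (b 1)
    simp only [← toBilinForm_apply, map_add, map_smul, LinearMap.add_apply, LinearMap.smul_apply,
      smul_eq_mul, h0, h1, ← h2]
    ring
  set a₀ := ρ₀ ![(b 0 : V), b 1] with ha₀
  set a₁ := ρ₁ ![(b 0 : V), b 1] with ha₁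
  have hne : a₀ ≠ 0 := by
    intro h
    refine hli.ne_zero 0 (hnd (b 0 : V) (b 0).2 fun w hw => ?_)
    obtain ⟨γ, δ, rfl⟩ := hexp w hw
    have := hval ρ₀ 1 0 γ δ
    rw [← ha₀, h, mul_zero] at this
    simpa using this
  have hs : 0 < a₀ ↔ 0 < a₁ := hsign _ (b 0).2 _ (b 1).2 hli
  have hs' : a₀ < 0 ↔ a₁ < 0 := by
    have h := hsign _ (b 1).2 _ (b 0).2 (by rwa [LinearIndependent.pair_symm_iff])
    rw [form_swap ρ₀ (b 0 : V), form_swap ρ₁ (b 0 : V)] at h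
    simpa using h
  have hc : 0 < a₀ / a₁ ∧ a₁ ≠ 0 := by
    rcases lt_or_gt_of_ne hne with h | h
    · exact ⟨div_pos_of_neg_of_neg h (hs'.1 h), (hs'.1 h).ne⟩
    · exact ⟨div_pos h (hs.1 h), (hs.1 h).ne'⟩
  refine ⟨a₀ / a₁, hc.1, fun v hv w hw => ?_⟩
  obtain ⟨α, β, rfl⟩ := hexp v hv
  obtain ⟨γ, δ, rfl⟩ := hexp w hw
  rw [hval, hval, ← ha₀, ← ha₁]
  field_simp [hc.2]

end Positivity

/-! ### Fibrations are submersions -/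

section Submersion

variable {EX : Type*} [NormedAddCommGroup EX] [NormedSpace ℝ EX]
  {EB : Type*} [NormedAddCommGroup EB] [NormedSpace ℝ EB]
  {EF : Type*} [NormedAddCommGroup EF] [NormedSpace ℝ EF]
  {X : Type*} [TopologicalSpace X] [ChartedSpace EX X]
  {B : Type*} [TopologicalSpace B] [ChartedSpace EB B]
  {F : Type*} [TopologicalSpace F] [ChartedSpace EF F]

/-- A smooth fibration is a submersion, since it has smooth local sections through every point. -/
theorem dproj_surjective {π : X → B} (hπ : IsSmoothFibration EF EX EB F π) (p : X) :
    Function.Surjective (dproj EX EB π p) := by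
  obtain ⟨e, hb, he, hes⟩ := hπ (π p)
  have hp : p ∈ e.source := e.mem_source.2 hb
  have hep : e p ∈ e.target := e.map_source hp
  have hπd : MDifferentiableAt 𝓘(ℝ, EX) 𝓘(ℝ, EB) π p := by
    have h1 : ContMDiffAt 𝓘(ℝ, EX) (𝓘(ℝ, EB).prod 𝓘(ℝ, EF)) ∞ e p :=
      he.contMDiffAt (e.open_source.mem_nhds hp)
    have h2 := (contMDiffAt_fst.comp p h1).mdifferentiableAt (by simp)
    exact h2.congr_of_eventuallyEq (e.coe_fst_eventuallyEq_proj hp).symm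
  let s : B → X := fun b => e.toOpenPartialHomeomorph.symm (b, (e p).2)
  have hpe : (π p, (e p).2) = e p := by rw [← e.coe_fst hp]
  have hsp : s (π p) = p := by
    simp only [s]
    rw [hpe]
    exact e.toOpenPartialHomeomorph.left_inv hp
  have hsd : MDifferentiableAt 𝓘(ℝ, EB) 𝓘(ℝ, EX) s (π p) := by
    have h1 : ContMDiffAt (𝓘(ℝ, EB).prod 𝓘(ℝ, EF)) 𝓘(ℝ, EX) ∞
        e.toOpenPartialHomeomorph.symm (π p, (e p).2) :=
      hes.contMDiffAt (e.open_target.mem_nhds (by rw [hpe]; exact hep))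
    have h2 : ContMDiffAt 𝓘(ℝ, EB) (𝓘(ℝ, EB).prod 𝓘(ℝ, EF)) ∞ (fun b : B => (b, (e p).2)) (π p) :=
      contMDiffAt_id.prodMk contMDiffAt_const
    exact (h1.comp (π p) h2).mdifferentiableAt (by simp)
  have hid : π ∘ s =ᶠ[𝓝 (π p)] id := by
    filter_upwards [e.open_baseSet.mem_nhds hb] with b hb'
    exact e.proj_symm_apply' hb'
  have hcomp : HasMFDerivAt 𝓘(ℝ, EB) 𝓘(ℝ, EB) (π ∘ s) (π p)
      ((dproj EX EB π (s (π p))).comp (mfderiv 𝓘(ℝ, EB) 𝓘(ℝ, EX) s (π p))) := by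
    have h1 : HasMFDerivAt 𝓘(ℝ, EX) 𝓘(ℝ, EB) π (s (π p)) (dproj EX EB π (s (π p))) := by
      rw [hsp]; exact hπd.hasMFDerivAt
    exact h1.comp (π p) hsd.hasMFDerivAt
  have hid' := (hasMFDerivAt_id (I := 𝓘(ℝ, EB)) (π p)).congr_of_eventuallyEq hid
  have heq := hasMFDerivAt_unique hcomp hid'
  rw [hsp] at heq
  intro y
  exact ⟨mfderiv 𝓘(ℝ, EB) 𝓘(ℝ, EX) s (π p) y, DFunLike.congr_fun heq y⟩

end Submersion

/-! ### The linear path as an isotopy -/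

section LinearPath

variable {E : Type*} [NormedAddCommGroup E] [NormedSpace ℝ E]
  {M : Type*} [TopologicalSpace M] [ChartedSpace E M]

theorem localRep_add {k : ℕ} (α β : FormField E M k) (x₀ : M) :
    localRep (α + β) x₀ = localRep α x₀ + localRep β x₀ := rfl

theorem localRep_smul {k : ℕ} (c : ℝ) (α : FormField E M k) (x₀ : M) :
    localRep (c • α) x₀ = c • localRep α x₀ := rfl

theorem IsSmoothForm.add {k : ℕ} {α β : FormField E M k} (hα : IsSmoothForm α)
    (hβ : IsSmoothForm β) : IsSmoothForm (α + β) := fun x₀ => by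
  rw [localRep_add]; exact (hα x₀).add (hβ x₀)

theorem IsSmoothForm.smul {k : ℕ} {α : FormField E M k} (c : ℝ) (hα : IsSmoothForm α) :
    IsSmoothForm (c • α) := fun x₀ => by
  rw [localRep_smul]; exact contDiffOn_const.smul (hα x₀)

theorem IsSmoothForm.differentiableAt {k : ℕ} {α : FormField E M k} (hα : IsSmoothForm α)
    {x₀ : M} {y : E} (hy : y ∈ (chartAt E x₀).target) : DifferentiableAt ℝ (localRep α x₀) y :=
  ((hα x₀).contDiffAt ((chartAt E x₀).open_target.mem_nhds hy)).differentiableAt (by simp)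

theorem HasExtDeriv.add {k : ℕ} {α β : FormField E M k} {α' β' : FormField E M (k + 1)}
    (hα : IsSmoothForm α) (hβ : IsSmoothForm β) (hα' : HasExtDeriv α α')
    (hβ' : HasExtDeriv β β') : HasExtDeriv (α + β) (α' + β') := fun x₀ y hy => by
  rw [localRep_add, localRep_add,
    extDeriv_add (hα.differentiableAt hy) (hβ.differentiableAt hy), hα' x₀ y hy, hβ' x₀ y hy,
    Pi.add_apply]

theorem HasExtDeriv.smul {k : ℕ} {α : FormField E M k} {α' : FormField E M (k + 1)} (c : ℝ)
    (hα' : HasExtDeriv α α') : HasExtDeriv (c • α) (c • α') := fun x₀ y hy => by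
  rw [localRep_smul, localRep_smul, extDeriv_smul, hα' x₀ y hy, Pi.smul_apply]

theorem isSmoothFamily_linear {k : ℕ} {α β : FormField E M k} (hα : IsSmoothForm α)
    (hβ : IsSmoothForm β) : IsSmoothFamily fun t : ℝ => (1 - t) • α + t • β := by
  intro x₀
  have hsnd : MapsTo Prod.snd (Icc (0 : ℝ) 1 ×ˢ (chartAt E x₀).target) (chartAt E x₀).target :=
    fun q hq => hq.2
  exact ((contDiffOn_const.sub contDiffOn_fst).smul ((hα x₀).comp contDiffOn_snd hsnd)).add
    (contDiffOn_fst.smul ((hβ x₀).comp contDiffOn_snd hsnd))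

/-- Cohomologous symplectic forms are isotopic as soon as the linear path between them is
nondegenerate. -/
theorem isotopic_of_linear {ω₀ ω₁ : FormField E M 2} (h₀ : IsSymplectic ω₀)
    (h₁ : IsSymplectic ω₁)
    (hnd : ∀ t ∈ Icc (0 : ℝ) 1, IsNondegenerate ((1 - t) • ω₀ + t • ω₁))
    (hcoh : Cohomologous ω₀ ω₁) : Isotopic ω₀ ω₁ := by
  obtain ⟨η, hη, hdη⟩ := hcoh
  refine ⟨fun t => (1 - t) • ω₀ + t • ω₁, isSmoothFamily_linear h₀.smooth h₁.smooth,
    by simp, by simp, fun t ht => ⟨⟨?_, ?_, hnd t ht⟩, t • η, hη.smul t, ?_⟩⟩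
  · exact (h₀.smooth.smul _).add (h₁.smooth.smul _)
  · simpa using HasExtDeriv.add (h₀.smooth.smul (1 - t)) (h₁.smooth.smul t)
      (h₀.closed.smul (1 - t)) (h₁.closed.smul t)
  · have h : (1 - t) • ω₀ + t • ω₁ - ω₀ = t • (ω₁ - ω₀) := by module
    rw [h]
    exact hdη.smul t

end LinearPath

/-! ### Nondegeneracy of the linear path -/

section Nondegeneracy

/-- `combination_nondegenerate` with its orthogonal lifts supplied: they are those of a positive basis
of the target of `L`, on which the sign conditions are assumed. -/
theorem combination_nondegenerate_of_positive {V V' : Type*} [AddCommGroup V] [Module ℝ V]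
    [TopologicalSpace V] [FiniteDimensional ℝ V] [AddCommGroup V'] [Module ℝ V']
    [FiniteDimensional ℝ V'] (hV' : Module.finrank ℝ V' = 2)
    {L : V →ₗ[ℝ] V'} (hL : Function.Surjective L) (o' : Orientation ℝ V' (Fin 2))
    {ρ₀ ρ₁ : V [⋀^Fin 2]→L[ℝ] ℝ}
    (hnd₀ : ∀ v ∈ LinearMap.ker L, (∀ w ∈ LinearMap.ker L, ρ₀ ![v, w] = 0) → v = 0)
    (hnd₁ : ∀ v ∈ LinearMap.ker L, (∀ w ∈ LinearMap.ker L, ρ₁ ![v, w] = 0) → v = 0)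
    (hprop : ∃ c : ℝ, 0 < c ∧ ∀ v ∈ LinearMap.ker L, ∀ w ∈ LinearMap.ker L,
      ρ₀ ![v, w] = c * ρ₁ ![v, w])
    (h₀ : ∀ u w : V, (∀ v ∈ LinearMap.ker L, ρ₀ ![w, v] = 0) → IsPositive o' ![L u, L w] →
      0 < ρ₀ ![u, w])
    (h₁ : ∀ u w : V, (∀ v ∈ LinearMap.ker L, ρ₁ ![w, v] = 0) → IsPositive o' ![L u, L w] →
      0 < ρ₁ ![u, w])
    (h₀₁ : ∀ u w : V, (∀ v ∈ LinearMap.ker L, ρ₀ ![u, v] = 0) →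
      (∀ v ∈ LinearMap.ker L, ρ₀ ![w, v] = 0) → IsPositive o' ![L u, L w] → 0 < ρ₁ ![u, w])
    {t : ℝ} (ht : t ∈ Icc (0 : ℝ) 1) {x : V}
    (hx : ∀ y, (1 - t) * ρ₀ ![x, y] + t * ρ₁ ![x, y] = 0) : x = 0 := by
  obtain ⟨c, hc, hprop⟩ := hprop
  let e := o'.someBasis (by simp [hV'])
  have he : e.orientation = o' := o'.someBasis_orientation _
  have hpos : IsPositive o' ![e 0, e 1] :=
    ⟨e, by ext i; fin_cases i <;> rfl, he⟩
  obtain ⟨u, hu, hu'⟩ := exists_orthogonal_lift (toBilinForm_isAlt ρ₀) hL hnd₀ (e 0)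
  obtain ⟨w, hw, hw'⟩ := exists_orthogonal_lift (toBilinForm_isAlt ρ₀) hL hnd₀ (e 1)
  obtain ⟨k, hk, hk'⟩ := exists_orthogonal_lift (toBilinForm_isAlt ρ₁) hL hnd₁ (e 0)
  obtain ⟨l, hl, hl'⟩ := exists_orthogonal_lift (toBilinForm_isAlt ρ₁) hL hnd₁ (e 1)
  refine combination_nondegenerate (toBilinForm_isAlt ρ₀) (toBilinForm_isAlt ρ₁) (L := L) hnd₁ hc
    hprop (hu.trans hk.symm) (hw.trans hl.symm) (fun y => ?_) hu' hw' hk' hl'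
    (h₀ u w hw' (by rwa [hu, hw])) (h₀₁ u w hu' hw' (by rwa [hu, hw]))
    (h₁ k l hl' (by rwa [hk, hl])) ht hx
  refine ⟨e.repr (L y) 0, e.repr (L y) 1, ?_⟩
  have h := e.sum_repr (L y)
  rw [Fin.sum_univ_two] at h
  rw [hu, hw, h]

/-- The forms of the linear path between compatible forms are nondegenerate. -/
theorem isNondegenerate_linear_path {m : ℕ}
    {EX : Type*} [NormedAddCommGroup EX] [NormedSpace ℝ EX] [FiniteDimensional ℝ EX]
    {EB : Type*} [NormedAddCommGroup EB] [NormedSpace ℝ EB] [FiniteDimensional ℝ EB]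
    {EF : Type*} [NormedAddCommGroup EF] [NormedSpace ℝ EF]
    {X : Type*} [TopologicalSpace X] [ChartedSpace EX X]
    {B : Type*} [TopologicalSpace B] [ChartedSpace EB B]
    {F : Type*} [TopologicalSpace F] [ChartedSpace EF F]
    (hEX : Module.finrank ℝ EX = 2 * m + 2) (hEB : Module.finrank ℝ EB = 2)
    {oX : ManifoldOrientation (2 * m + 2) EX X} {oB : ManifoldOrientation 2 EB B} {π : X → B}
    (hπ : IsSmoothFibration EF EX EB F π) {ω₀ ω₁ : FormField EX X 2}
    (hω₀ : IsCompatible m oX oB π ω₀) (hω₁ : IsCompatible m oX oB π ω₁)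
    (hpos : IsPositiveOnHorizontal oB π ω₀ ω₁)
    (hF : 2 * m = 2 ∨ EqualOnFibers EB π ω₀ ω₁) {t : ℝ} (ht : t ∈ Icc (0 : ℝ) 1) :
    IsNondegenerate ((1 - t) • ω₀ + t • ω₁) := by
  intro p x hx
  have : FiniteDimensional ℝ (TangentSpace 𝓘(ℝ, EX) p) := inferInstanceAs (FiniteDimensional ℝ EX)
  have : FiniteDimensional ℝ (TangentSpace 𝓘(ℝ, EB) (π p)) :=
    inferInstanceAs (FiniteDimensional ℝ EB)
  have hV : Module.finrank ℝ (TangentSpace 𝓘(ℝ, EX) p) = 2 * m + 2 := hEX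
  have hV' : Module.finrank ℝ (TangentSpace 𝓘(ℝ, EB) (π p)) = 2 := hEB
  have hL : Function.Surjective (dproj EX EB π p).toLinearMap := dproj_surjective hπ p
  refine combination_nondegenerate_of_positive hV' hL (oB.orient (π p))
    (hω₀.fiber_nondegenerate p) (hω₁.fiber_nondegenerate p) ?_
    (fun u w hw => pos_on_orthogonal hV hV' hL (hω₀.orients_total p) (hω₀.orients_fiber p) hw)
    (fun u w hw => pos_on_orthogonal hV hV' hL (hω₁.orients_total p) (hω₁.orients_fiber p) hw)
    (fun u w hu hw h => (hpos p).2 u hu w hw h) ht hx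
  rcases hF with hm | heq
  · obtain rfl : m = 1 := by omega
    refine exists_pos_proportional (finrank_ker_of_surjective hV hV' hL)
      (hω₀.fiber_nondegenerate p) fun a ha b hb _ => ?_
    let e := (oB.orient (π p)).someBasis (by simp [hV'])
    obtain ⟨u, hu⟩ := hL (e 0)
    obtain ⟨w, hw⟩ := hL (e 1)
    have he : IsPositive (oB.orient (π p)) ![dproj EX EB π p u, dproj EX EB π p w] :=
      ⟨e, by ext1 i; fin_cases i; exacts [hu.symm, hw.symm],
        Orientation.someBasis_orientation _ _⟩
    have hab : ∀ i : Fin (2 * 1), (![a, b] : Fin (2 * 1) → _) i ∈ vertical EX EB π p := by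
      intro i; fin_cases i; exacts [ha, hb]
    have h := (hω₀.orients_fiber p ![a, b] u w hab he).symm.trans
      (hω₁.orients_fiber p ![a, b] u w hab he)
    rw [topPower_one, topPower_one] at h
    simpa using h
  · exact ⟨1, one_pos, fun v hv w hw => by rw [one_mul]; exact heq p v hv w hw⟩

end Nondegeneracy

end SympFib

theorem mainTheorem10 (m : ℕ)
    {X : Type*} [TopologicalSpace X] [T2Space X] [CompactSpace X]
    [ChartedSpace (EuclideanSpace ℝ (Fin (2 * m + 2))) X]
    [IsManifold 𝓘(ℝ, EuclideanSpace ℝ (Fin (2 * m + 2))) ∞ X]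
    {B : Type*} [TopologicalSpace B] [T2Space B]
    [ChartedSpace (EuclideanSpace ℝ (Fin 2)) B]
    [IsManifold 𝓘(ℝ, EuclideanSpace ℝ (Fin 2)) ∞ B]
    {F : Type*} [TopologicalSpace F]
    [ChartedSpace (EuclideanSpace ℝ (Fin (2 * m))) F]
    [IsManifold 𝓘(ℝ, EuclideanSpace ℝ (Fin (2 * m))) ∞ F]
    (oX : SympFib.ManifoldOrientation (2 * m + 2) (EuclideanSpace ℝ (Fin (2 * m + 2))) X)
    (oB : SympFib.ManifoldOrientation 2 (EuclideanSpace ℝ (Fin 2)) B)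
    (π : X → B)
    (hπ : SympFib.IsSmoothFibration (EuclideanSpace ℝ (Fin (2 * m)))
      (EuclideanSpace ℝ (Fin (2 * m + 2))) (EuclideanSpace ℝ (Fin 2)) F π)
    (ω₀ ω₁ : SympFib.FormField (EuclideanSpace ℝ (Fin (2 * m + 2))) X 2)
    (hω₀ : SympFib.IsCompatible m oX oB π ω₀)
    (hω₁ : SympFib.IsCompatible m oX oB π ω₁)
    (hpos : SympFib.IsPositiveOnHorizontal oB π ω₀ ω₁)
    (hF : 2 * m = 2 ∨ SympFib.EqualOnFibers (EuclideanSpace ℝ (Fin 2)) π ω₀ ω₁) :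
    (∀ t ∈ Set.Icc (0 : ℝ) 1, SympFib.IsNondegenerate ((1 - t) • ω₀ + t • ω₁)) ∧
    (SympFib.Cohomologous ω₀ ω₁ → SympFib.Isotopic ω₀ ω₁) := by
  have h : ∀ t ∈ Set.Icc (0 : ℝ) 1, SympFib.IsNondegenerate ((1 - t) • ω₀ + t • ω₁) := fun _ ht =>
    SympFib.isNondegenerate_linear_path (by simp) (by simp) hπ hω₀ hω₁ hpos hF ht
  exact ⟨h, SympFib.isotopic_of_linear hω₀.symplectic hω₁.symplectic h⟩
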